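/- Let $A\in\mathbb R^{n\times n}$, $B\in\mathbb R^{n\times m}$, $C\in\mathbb R^{p\times n}$, $D\in\mathbb R^{p\times m}$ be the matrices of the linear time-invariant system $x_k=Ax_{k-1}+Bu_{k-1}$, $y_k=Cx_k+Du_k$, with $(A,B)$ controllable (hence stabilizable) and $(A,C)$ observable, in the sense of the Kalman rank conditions. Put $\Phi=\begin{bmatrix}A&B\\0&I_m\end{bmatrix}$ and $H=\begin{bmatrix}C&D\\0&I_m\end{bmatrix}$. Let $W\in\mathbb R^{p\times p}$, $M\in\mathbb R^{p\times m}$, $R\in\mathbb R^{m\times m}$ be weights with $\begin{bmatrix}W&M\\M^\top&R\end{bmatrix}$ symmetric positive definite, let $\tilde R\in\mathbb R^{m\times m}$ be a symmetric positive definite weight on the control increments, and put $$\grave R=\begin{bmatrix}W&M\\M^\top&R\end{bmatrix}^{-1},\qquad \grave Q=\begin{bmatrix}0&0\\0&\tilde R^{-1}\end{bmatrix}.$$ Let $\hat x\in\mathbb R^n$, $u_{\mathrm{last}}\in\mathbb R^m$, and let $(z_k)_{k\ge0}$ be a reference sequence in $\mathbb R^{p+m}$ that is Lipschitz, i.e.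 $\|z_{k+1}-z_k\|\le\ell$ for some $\ell$ and all $k$ (for example, any constant or bounded sequence). Run the Kalman filter from $\chi_{0(-)}=(\hat x,u_{\mathrm{last}})$, $P_{0(-)}=\grave Q$: for $k\ge0$, $$K_k=P_{k(-)}H^\top(HP_{k(-)}H^\top+\grave R)^{-1},\quad \chi_{k(+)}=\chi_{k(-)}+K_k(z_k-H\chi_{k(-)}),\quad P_{k(+)}=(I-K_kH)P_{k(-)},$$ $$\chi_{k+1(-)}=\Phi\chi_{k(+)},\qquad P_{k+1(-)}=\Phi P_{k(+)}\Phi^\top+\grave Q.$$ Let $L_k=P_{k(+)}\Phi^\top P_{k+1(-)}^{+}$, where $P^{+}$ is the Moore–Penrose inverse ($P^{+}=P^{-1}$ if $P$ is invertible). For a horizon $N\ge0$ let $\chi_{N[s]}=\chi_{N(+)}$ and, for $k=N-1,\dots,0$, $\chi_{k[s]}=\chi_{k(+)}+L_k(\chi_{k+1[s]}-\chi_{k+1(-)})$, and let $u_0^{[N]}\in\mathbb R^m$ be the last $m$ coordinates of $\chi_{0[s]}$. Let $\Gamma_{-1}=\begin{bmatrix}0&I_m\end{bmatrix}\in\mathbb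 R^{m\times(n+m)}$ and $\Gamma_k=\Gamma_{k-1}L_k$ for $k\ge0$. Then $\Gamma_k\to0$ as $k\to\infty$, and for every $\delta_1>0$ there is $N_0\ge1$ such that for every horizon $N\ge N_0$ $$\|u_0^{[N]}-u_0^{[N-1]}\|\le\delta_1$$ in the Euclidean norm; in particular, there is a horizon $N\geq 1$ with this property. -/

import Mathlib

open Matrix Filter Topology

noncomputable section

namespace ObservedControl

/-! ### The Moore–Penrose inverse -/

/-- The Moore–Penrose inverse `A⁺ = (AᵀA)⁺ Aᵀ` of a real matrix. The pseudo-inverse of the symmetric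
matrix `AᵀA` inverts its non-zero eigenvalues and keeps the eigenvalue zero
(in `ℝ`, `0⁻¹ = 0`). -/
def pinv {ι κ : Type*} [Fintype ι] [Fintype κ] [DecidableEq κ] (A : Matrix ι κ ℝ) :
    Matrix κ ι ℝ :=
  cfc (fun t : ℝ => t⁻¹) (Aᵀ * A) * Aᵀ

/-- `(AᵀA)⁺` is a symmetric generalized inverse of `AᵀA`. -/
theorem gram_pinv {ι κ : Type*} [Fintype ι] [Fintype κ] [DecidableEq κ] (A : Matrix ι κ ℝ) :
    (cfc (fun t : ℝ => t⁻¹) (Aᵀ * A))ᵀ = cfc (fun t : ℝ => t⁻¹) (Aᵀ * A) ∧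
    (Aᵀ * A) * cfc (fun t : ℝ => t⁻¹) (Aᵀ * A) * (Aᵀ * A) = Aᵀ * A ∧
    cfc (fun t : ℝ => t⁻¹) (Aᵀ * A) * (Aᵀ * A) * cfc (fun t : ℝ => t⁻¹) (Aᵀ * A) =
      cfc (fun t : ℝ => t⁻¹) (Aᵀ * A) ∧
    cfc (fun t : ℝ => t⁻¹) (Aᵀ * A) * (Aᵀ * A) = (Aᵀ * A) * cfc (fun t : ℝ => t⁻¹) (Aᵀ * A) := by
  have hA : IsSelfAdjoint (Aᵀ * A) := by
    rw [IsSelfAdjoint, star_eq_conjTranspose, conjTranspose_eq_transpose_of_trivial]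
    simp
  have hc : ∀ f : ℝ → ℝ, ContinuousOn f (spectrum ℝ (Aᵀ * A)) := fun f =>
    (Matrix.finite_real_spectrum (A := Aᵀ * A)).continuousOn f
  have hid : cfc (fun t : ℝ => t) (Aᵀ * A) = Aᵀ * A := cfc_id' ℝ _
  refine ⟨?_, ?_, ?_, ?_⟩
  · have h := cfc_predicate (fun t : ℝ => t⁻¹) (Aᵀ * A)
    rw [IsSelfAdjoint, star_eq_conjTranspose, conjTranspose_eq_transpose_of_trivial] at h
    exact h
  · generalize hg : cfc (fun t : ℝ => t⁻¹) (Aᵀ * A) = G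
    conv_rhs => rw [← hid]
    conv_lhs => rw [← hid]
    rw [← hg, ← cfc_mul _ _ _ (hc _) (hc _), ← cfc_mul _ _ _ (hc _) (hc _)]
    exact cfc_congr fun t _ => by simp
  · generalize hg : cfc (fun t : ℝ => t⁻¹) (Aᵀ * A) = G
    conv_lhs => rw [← hid]
    rw [← hg, ← cfc_mul _ _ _ (hc _) (hc _), ← cfc_mul _ _ _ (hc _) (hc _)]
    exact cfc_congr fun t _ => by
      by_cases h : t = 0 <;> simp [h]
  · generalize hg : cfc (fun t : ℝ => t⁻¹) (Aᵀ * A) = G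
    conv_lhs => rw [← hid]
    conv_rhs => rw [← hid]
    rw [← hg, ← cfc_mul _ _ _ (hc _) (hc _), ← cfc_mul _ _ _ (hc _) (hc _)]
    exact cfc_congr fun t _ => mul_comm _ _

/-- The four Penrose equations. -/
theorem pinv_penrose {ι κ : Type*} [Fintype ι] [Fintype κ] [DecidableEq κ] (A : Matrix ι κ ℝ) :
    A * pinv A * A = A ∧ pinv A * A * pinv A = pinv A ∧
      (A * pinv A)ᵀ = A * pinv A ∧ (pinv A * A)ᵀ = pinv A * A := by
  obtain ⟨h1, h2, h3, h4⟩ := gram_pinv A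
  unfold pinv
  generalize cfc (fun t : ℝ => t⁻¹) (Aᵀ * A) = G at *
  have hs : (A * (G * Aᵀ))ᵀ = A * (G * Aᵀ) := by
    simp [Matrix.transpose_mul, h1, Matrix.mul_assoc]
  refine ⟨?_, ?_, hs, ?_⟩
  · have h5 : Aᴴ * A * (G * Aᵀ * A - 1) = 0 := by
      rw [conjTranspose_eq_transpose_of_trivial, Matrix.mul_sub, Matrix.mul_one, sub_eq_zero]
      simpa only [Matrix.mul_assoc] using h2
    have h6 := (Matrix.conjTranspose_mul_self_mul_eq_zero A (G * Aᵀ * A - 1)).1 h5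
    rw [Matrix.mul_sub, Matrix.mul_one, sub_eq_zero] at h6
    simpa only [Matrix.mul_assoc] using h6
  · have := congrArg (· * Aᵀ) h3
    simpa only [Matrix.mul_assoc] using this
  · rw [Matrix.mul_assoc, Matrix.transpose_mul, Matrix.transpose_mul, Matrix.transpose_transpose,
      h1, h4]

/-- The Moore–Penrose inverse of an invertible matrix is its inverse. -/
theorem pinv_eq_inv {ι : Type*} [Fintype ι] [DecidableEq ι] (A : Matrix ι ι ℝ)
    (hA : IsUnit A.det) : pinv A = A⁻¹ := by
  have h := (pinv_penrose A).1
  calc pinv A = A⁻¹ * (A * pinv A * A) * A⁻¹ := by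
        rw [Matrix.mul_assoc A, Matrix.nonsing_inv_mul_cancel_left _ _ hA,
          Matrix.mul_nonsing_inv_cancel_right _ _ hA]
    _ = A⁻¹ := by rw [h, Matrix.nonsing_inv_mul _ hA, Matrix.one_mul]

/-! ### Controllability and observability (Kalman rank conditions) -/

/-- The controllability matrix `[B, AB, …, A^(n-1) B]`. -/
def controllabilityMatrix {n m : ℕ} (A : Matrix (Fin n) (Fin n) ℝ) (B : Matrix (Fin n) (Fin m) ℝ) :
    Matrix (Fin n) (Fin n × Fin m) ℝ :=
  Matrix.of fun i kj => (A ^ (kj.1 : ℕ) * B) i kj.2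

/-- The observability matrix, with block rows `C, CA, …, C A^(n-1)`. -/
def observabilityMatrix {n p : ℕ} (A : Matrix (Fin n) (Fin n) ℝ) (C : Matrix (Fin p) (Fin n) ℝ) :
    Matrix (Fin n × Fin p) (Fin n) ℝ :=
  Matrix.of fun ki j => (C * A ^ (ki.1 : ℕ)) ki.2 j

/-- The pair `(A, B)` is controllable. -/
def Controllable {n m : ℕ} (A : Matrix (Fin n) (Fin n) ℝ) (B : Matrix (Fin n) (Fin m) ℝ) : Prop :=
  (controllabilityMatrix A B).rank = n

/-- The pair `(A, C)` is observable. -/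
def Observable {n p : ℕ} (A : Matrix (Fin n) (Fin n) ℝ) (C : Matrix (Fin p) (Fin n) ℝ) : Prop :=
  (observabilityMatrix A C).rank = n

/-! ### Kalman filter and Rauch–Tung–Striebel smoother for
`χ (k+1) = Φ χ k + w`, `z k = H χ k + v`, with covariances `Q` of `w` and `R` of `v` -/

section Filter

variable {ι κ : Type*} [Fintype ι] [DecidableEq ι] [Fintype κ] [DecidableEq κ]

/-- Kalman gain `K = P Hᵀ (H P Hᵀ + R)⁻¹` for the prior covariance `P`. -/
def kalmanGain (H : Matrix κ ι ℝ) (R : Matrix κ κ ℝ) (P : Matrix ι ι ℝ) : Matrix ι κ ℝ :=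
  P * Hᵀ * (H * P * Hᵀ + R)⁻¹

/-- Posterior covariance `(I - K H) P` for the prior covariance `P`. -/
def covUpdate (H : Matrix κ ι ℝ) (R : Matrix κ κ ℝ) (P : Matrix ι ι ℝ) : Matrix ι ι ℝ :=
  (1 - kalmanGain H R P * H) * P

/-- Prior covariances `P_{k(-)}`, started at `P_{0(-)} = P₀`. -/
def priorCov (Φ : Matrix ι ι ℝ) (H : Matrix κ ι ℝ) (Q : Matrix ι ι ℝ) (R : Matrix κ κ ℝ)
    (P₀ : Matrix ι ι ℝ) : ℕ → Matrix ι ι ℝ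
  | 0 => P₀
  | k + 1 => Φ * covUpdate H R (priorCov Φ H Q R P₀ k) * Φᵀ + Q

/-- Posterior covariances `P_{k(+)}`. -/
def postCov (Φ : Matrix ι ι ℝ) (H : Matrix κ ι ℝ) (Q : Matrix ι ι ℝ) (R : Matrix κ κ ℝ)
    (P₀ : Matrix ι ι ℝ) (k : ℕ) : Matrix ι ι ℝ :=
  covUpdate H R (priorCov Φ H Q R P₀ k)

/-- Posterior estimate `χ + K (z - H χ)` from the prior estimate `χ`, the prior covariance `P` and
the measurement `z`. -/
def stateUpdate (H : Matrix κ ι ℝ) (R : Matrix κ κ ℝ) (P : Matrix ι ι ℝ) (z : κ → ℝ)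
    (χ : ι → ℝ) : ι → ℝ :=
  χ + kalmanGain H R P *ᵥ (z - H *ᵥ χ)

/-- Prior estimates `χ_{k(-)}`, started at `χ_{0(-)} = χ₀`. -/
def priorState (Φ : Matrix ι ι ℝ) (H : Matrix κ ι ℝ) (Q : Matrix ι ι ℝ) (R : Matrix κ κ ℝ)
    (P₀ : Matrix ι ι ℝ) (χ₀ : ι → ℝ) (z : ℕ → κ → ℝ) : ℕ → ι → ℝ
  | 0 => χ₀
  | k + 1 => Φ *ᵥ stateUpdate H R (priorCov Φ H Q R P₀ k) (z k) (priorState Φ H Q R P₀ χ₀ z k)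

/-- Posterior estimates `χ_{k(+)}`. -/
def postState (Φ : Matrix ι ι ℝ) (H : Matrix κ ι ℝ) (Q : Matrix ι ι ℝ) (R : Matrix κ κ ℝ)
    (P₀ : Matrix ι ι ℝ) (χ₀ : ι → ℝ) (z : ℕ → κ → ℝ) (k : ℕ) : ι → ℝ :=
  stateUpdate H R (priorCov Φ H Q R P₀ k) (z k) (priorState Φ H Q R P₀ χ₀ z k)

/-- Smoother gain `L_k = P_{k(+)} Φᵀ P_{k+1(-)}⁻¹`. The inverse is the Moore–Penrose one, since the
first prior covariances of the augmented system are singular as soon as `B` lacks full row rank. -/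
def smootherGain (Φ : Matrix ι ι ℝ) (H : Matrix κ ι ℝ) (Q : Matrix ι ι ℝ) (R : Matrix κ κ ℝ)
    (P₀ : Matrix ι ι ℝ) (k : ℕ) : Matrix ι ι ℝ :=
  postCov Φ H Q R P₀ k * Φᵀ * pinv (priorCov Φ H Q R P₀ (k + 1))

/-- `smoothedState … j k` is the smoothed estimate `χ_{k[s]}` for the horizon `N = k + j`, computed by
the backward pass `χ_{N[s]} = χ_{N(+)}`,
`χ_{k[s]} = χ_{k(+)} + L_k (χ_{k+1[s]} - χ_{k+1(-)})`. -/
def smoothedState (Φ : Matrix ι ι ℝ) (H : Matrix κ ι ℝ) (Q : Matrix ι ι ℝ) (R : Matrix κ κ ℝ)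
    (P₀ : Matrix ι ι ℝ) (χ₀ : ι → ℝ) (z : ℕ → κ → ℝ) : ℕ → ℕ → ι → ℝ
  | 0, k => postState Φ H Q R P₀ χ₀ z k
  | j + 1, k => postState Φ H Q R P₀ χ₀ z k + smootherGain Φ H Q R P₀ k *ᵥ
      (smoothedState Φ H Q R P₀ χ₀ z j (k + 1) - priorState Φ H Q R P₀ χ₀ z (k + 1))

end Filter

/-! ### Observed control -/

section Augmented

variable {n m p : ℕ}

/-- The augmented system matrix `Φ = [A B; 0 I]`. -/
def augPhi (A : Matrix (Fin n) (Fin n) ℝ) (B : Matrix (Fin n) (Fin m) ℝ) :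
    Matrix (Fin n ⊕ Fin m) (Fin n ⊕ Fin m) ℝ :=
  fromBlocks A B 0 1

/-- The augmented measurement matrix `H = [C D; 0 I]`. -/
def augH (C : Matrix (Fin p) (Fin n) ℝ) (D : Matrix (Fin p) (Fin m) ℝ) :
    Matrix (Fin p ⊕ Fin m) (Fin n ⊕ Fin m) ℝ :=
  fromBlocks C D 0 1

/-- The weight `[W M; Mᵀ R]` on outputs and controls in the quadratic cost. -/
def costWeight (W : Matrix (Fin p) (Fin p) ℝ) (M : Matrix (Fin p) (Fin m) ℝ)
    (R : Matrix (Fin m) (Fin m) ℝ) : Matrix (Fin p ⊕ Fin m) (Fin p ⊕ Fin m) ℝ :=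
  fromBlocks W M Mᵀ R

/-- The process covariance `[0 0; 0 Rt⁻¹]`, where `Rt` is the weight on control increments. -/
def augQ (Rt : Matrix (Fin m) (Fin m) ℝ) : Matrix (Fin n ⊕ Fin m) (Fin n ⊕ Fin m) ℝ :=
  fromBlocks 0 0 0 Rt⁻¹

/-- The control `u_0^{[N]}` of observed control with horizon `N`: the control block of the smoothed
estimate `χ_{0[s]}`, for the filter started at `χ_{0(-)} = (x₀, uLast)` with covariance `augQ Rt`, with
measurement covariance `[W M; Mᵀ R]⁻¹` and measurements `z 0, …, z N`. -/
def control (A : Matrix (Fin n) (Fin n) ℝ) (B : Matrix (Fin n) (Fin m) ℝ)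
    (C : Matrix (Fin p) (Fin n) ℝ) (D : Matrix (Fin p) (Fin m) ℝ)
    (W : Matrix (Fin p) (Fin p) ℝ) (M : Matrix (Fin p) (Fin m) ℝ)
    (R Rt : Matrix (Fin m) (Fin m) ℝ) (x₀ : Fin n → ℝ) (uLast : Fin m → ℝ)
    (z : ℕ → Fin p ⊕ Fin m → ℝ) (N : ℕ) : EuclideanSpace ℝ (Fin m) :=
  WithLp.toLp 2 fun i =>
    smoothedState (augPhi A B) (augH C D) (augQ Rt) (costWeight W M R)⁻¹ (augQ Rt)
      (Sum.elim x₀ uLast) z N 0 (Sum.inr i)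

/-- The gain accumulator, shifted by one: `gainAccumulator … k` is `Γ_{k-1}`, where `Γ_{-1} = [0 I]`
and `Γ_k = Γ_{k-1} L_k`. -/
def gainAccumulator (A : Matrix (Fin n) (Fin n) ℝ) (B : Matrix (Fin n) (Fin m) ℝ)
    (C : Matrix (Fin p) (Fin n) ℝ) (D : Matrix (Fin p) (Fin m) ℝ)
    (W : Matrix (Fin p) (Fin p) ℝ) (M : Matrix (Fin p) (Fin m) ℝ)
    (R Rt : Matrix (Fin m) (Fin m) ℝ) : ℕ → Matrix (Fin m) (Fin n ⊕ Fin m) ℝ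
  | 0 => fromCols 0 1
  | k + 1 => gainAccumulator A B C D W M R Rt k *
      smootherGain (augPhi A B) (augH C D) (augQ Rt) (costWeight W M R)⁻¹ (augQ Rt) k

end Augmented

end ObservedControl

end

/-! Extending the horizon from $N-1$ to $N$ changes $u_0$ by $\Gamma_{N-1}$ applied to the last
filter correction $K_N(z_N-H\chi_{N(-)})$ (`gain_mulVec_smoothedState_sub`). The gain
$K_N=P_{N(-)}H^\top(\cdots)^{-1}$ begins with $P_{N(-)}$, so the product
$\Theta_k=\Gamma_{k-1}P_{k(-)}$ is what matters. With $F_k=\Phi(I-K_kH)$, the identity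
$L_kP_{k+1(-)}=P_{k(-)}F_k^\top$ (`smootherGain_mul_priorCov`) gives
$\Theta_{k+1}=\Theta_kF_k^\top$, and the question becomes the stability of the filter.

The covariances started at $\grave Q$ increase, and they are bounded by observability, so they
converge. Controllability makes the limit positive definite (`exists_tendsto_priorCov`). The
limiting Riccati equation is a Lyapunov equation for the limiting $F$, which is therefore a strict
contraction in a suitable Euclidean norm. By continuity the $F_k$ are eventually uniform
contractions in that same norm (`exists_eventually_contraction`).

Hence $\Theta_k$ decays geometrically, while a Lipschitz reference lets the prior estimates and
innovations grow at most linearly. The product tends to zero, and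
$\Gamma_{k-1}=\Theta_kP_{k(-)}^{-1}\to0$ because the limiting covariance is invertible. -/

namespace ObservedControl

/-! ### The Riccati recursion: monotonicity, boundedness, convergence. -/

section Riccati

set_option linter.unusedSectionVars false

variable {ι κ : Type*} [Fintype ι] [DecidableEq ι] [Fintype κ] [DecidableEq κ]

theorem posSemidef_conj {P : Matrix ι ι ℝ} (hP : P.PosSemidef) (B : Matrix κ ι ℝ) :
    (B * P * Bᵀ).PosSemidef := by
  simpa using hP.mul_mul_conjTranspose_same B

theorem transpose_eq_of_posSemidef {P : Matrix ι ι ℝ} (hP : P.PosSemidef) : Pᵀ = P := by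
  simpa using hP.isHermitian.eq

theorem innovationCov_posDef (H : Matrix κ ι ℝ) {R : Matrix κ κ ℝ} (hR : R.PosDef)
    {P : Matrix ι ι ℝ} (hP : P.PosSemidef) : (H * P * Hᵀ + R).PosDef :=
  Matrix.PosDef.posSemidef_add (posSemidef_conj hP H) hR

theorem kalmanGain_mul_innovationCov (H : Matrix κ ι ℝ) {R : Matrix κ κ ℝ} (hR : R.PosDef)
    {P : Matrix ι ι ℝ} (hP : P.PosSemidef) :
    kalmanGain H R P * (H * P * Hᵀ + R) = P * Hᵀ := by
  have hu := (Matrix.isUnit_iff_isUnit_det _).1 (innovationCov_posDef H hR hP).isUnit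
  rw [kalmanGain, Matrix.mul_assoc, Matrix.nonsing_inv_mul _ hu, Matrix.mul_one]

/-- The posterior covariance of the linear update with an arbitrary gain `K`. -/
def josephCov (H : Matrix κ ι ℝ) (R : Matrix κ κ ℝ) (P : Matrix ι ι ℝ) (K : Matrix ι κ ℝ) :
    Matrix ι ι ℝ :=
  (1 - K * H) * P * (1 - K * H)ᵀ + K * R * Kᵀ

/-- Completion of the square: the Kalman gain minimizes the posterior covariance. -/
theorem josephCov_eq (H : Matrix κ ι ℝ) {R : Matrix κ κ ℝ} (hR : R.PosDef)
    {P : Matrix ι ι ℝ} (hP : P.PosSemidef) (K : Matrix ι κ ℝ) :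
    josephCov H R P K = covUpdate H R P +
      (K - kalmanGain H R P) * (H * P * Hᵀ + R) * (K - kalmanGain H R P)ᵀ := by
  have h1 := kalmanGain_mul_innovationCov H hR hP
  have hS : (H * P * Hᵀ + R)ᵀ = H * P * Hᵀ + R :=
    transpose_eq_of_posSemidef (innovationCov_posDef H hR hP).posSemidef
  have h2 : (H * P * Hᵀ + R) * (kalmanGain H R P)ᵀ = H * P := by
    have := congrArg Matrix.transpose h1
    rwa [Matrix.transpose_mul, hS, Matrix.transpose_mul, Matrix.transpose_transpose,
      transpose_eq_of_posSemidef hP] at this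
  unfold josephCov covUpdate
  generalize kalmanGain H R P = G at *
  have e : (K - G) * (H * P * Hᵀ + R) * (K - G)ᵀ =
      K * (H * P * Hᵀ + R) * Kᵀ - K * ((H * P * Hᵀ + R) * Gᵀ) -
        G * (H * P * Hᵀ + R) * Kᵀ + G * ((H * P * Hᵀ + R) * Gᵀ) := by
    simp only [Matrix.transpose_sub, Matrix.mul_sub, Matrix.sub_mul, Matrix.mul_assoc]
    abel
  rw [e, h1, h2]
  simp only [Matrix.transpose_sub, Matrix.transpose_mul, Matrix.transpose_one, Matrix.mul_sub,
    Matrix.sub_mul, Matrix.mul_add, Matrix.add_mul, Matrix.mul_assoc, Matrix.mul_one,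
    Matrix.one_mul]
  abel

theorem covUpdate_eq_josephCov (H : Matrix κ ι ℝ) {R : Matrix κ κ ℝ} (hR : R.PosDef)
    {P : Matrix ι ι ℝ} (hP : P.PosSemidef) :
    covUpdate H R P = josephCov H R P (kalmanGain H R P) := by
  simp [josephCov_eq H hR hP]

theorem covUpdate_posSemidef (H : Matrix κ ι ℝ) {R : Matrix κ κ ℝ} (hR : R.PosDef)
    {P : Matrix ι ι ℝ} (hP : P.PosSemidef) : (covUpdate H R P).PosSemidef := by
  rw [covUpdate_eq_josephCov H hR hP]
  exact (posSemidef_conj hP _).add (posSemidef_conj hR.posSemidef _)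

theorem covUpdate_le_josephCov (H : Matrix κ ι ℝ) {R : Matrix κ κ ℝ} (hR : R.PosDef)
    {P : Matrix ι ι ℝ} (hP : P.PosSemidef) (K : Matrix ι κ ℝ) :
    (josephCov H R P K - covUpdate H R P).PosSemidef := by
  rw [josephCov_eq H hR hP, add_sub_cancel_left]
  exact posSemidef_conj (innovationCov_posDef H hR hP).posSemidef _

/-- For a fixed gain the Joseph form is monotone in the prior covariance. Taking the gain optimal
for `P'`, which is merely admissible for `P`, and then minimizing for `P` gives the inequality. -/
theorem covUpdate_mono (H : Matrix κ ι ℝ) {R : Matrix κ κ ℝ} (hR : R.PosDef)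
    {P P' : Matrix ι ι ℝ} (hP : P.PosSemidef) (hP' : P'.PosSemidef) (h : (P' - P).PosSemidef) :
    (covUpdate H R P' - covUpdate H R P).PosSemidef := by
  set K := kalmanGain H R P'
  have e : covUpdate H R P' - covUpdate H R P =
      (1 - K * H) * (P' - P) * (1 - K * H)ᵀ + (josephCov H R P K - covUpdate H R P) := by
    rw [covUpdate_eq_josephCov H hR hP']
    change josephCov H R P' K - _ = _
    rw [josephCov, josephCov, Matrix.mul_sub (1 - K * H),
      Matrix.sub_mul ((1 - K * H) * P')]
    abel
  rw [e]
  exact (posSemidef_conj h _).add (covUpdate_le_josephCov H hR hP K)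

/-- The quadratic form of a congruent matrix. -/
theorem dotProduct_conj_mulVec {α : Type*} [Fintype α] (B : Matrix ι α ℝ) (M : Matrix α α ℝ)
    (v : ι → ℝ) : v ⬝ᵥ (B * M * Bᵀ) *ᵥ v = (Bᵀ *ᵥ v) ⬝ᵥ M *ᵥ (Bᵀ *ᵥ v) := by
  rw [← Matrix.mulVec_mulVec, ← Matrix.mulVec_mulVec, Matrix.dotProduct_mulVec,
    ← Matrix.mulVec_transpose]

/-- The posterior covariance has the same kernel as the prior covariance. -/
theorem mulVec_eq_zero_of_covUpdate (H : Matrix κ ι ℝ) {R : Matrix κ κ ℝ} (hR : R.PosDef)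
    {P : Matrix ι ι ℝ} (hP : P.PosSemidef) {v : ι → ℝ}
    (hv : v ⬝ᵥ covUpdate H R P *ᵥ v = 0) : v ⬝ᵥ P *ᵥ v = 0 := by
  rw [covUpdate_eq_josephCov H hR hP, josephCov] at hv
  set K := kalmanGain H R P
  rw [Matrix.add_mulVec, dotProduct_add, dotProduct_conj_mulVec, dotProduct_conj_mulVec] at hv
  have h1 := hP.dotProduct_mulVec_nonneg ((1 - K * H)ᵀ *ᵥ v)
  have h2 := hR.posSemidef.dotProduct_mulVec_nonneg (Kᵀ *ᵥ v)
  rw [star_trivial] at h1 h2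
  have h3 : Kᵀ *ᵥ v = 0 := by
    by_contra h
    have := hR.dotProduct_mulVec_pos h
    rw [star_trivial] at this
    linarith
  have h4 : (1 - K * H)ᵀ *ᵥ v = v := by
    rw [Matrix.transpose_sub, Matrix.transpose_one, Matrix.transpose_mul, Matrix.sub_mulVec,
      Matrix.one_mulVec, ← Matrix.mulVec_mulVec, h3, Matrix.mulVec_zero, sub_zero]
  rw [h4] at hv h1
  linarith

variable (Φ : Matrix ι ι ℝ) (H : Matrix κ ι ℝ) {Q : Matrix ι ι ℝ} {R : Matrix κ κ ℝ}

theorem priorCov_posSemidef (hQ : Q.PosSemidef) (hR : R.PosDef) (k : ℕ) :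
    (priorCov Φ H Q R Q k).PosSemidef := by
  induction k with
  | zero => exact hQ
  | succ k ih => exact (posSemidef_conj (covUpdate_posSemidef H hR ih) Φ).add hQ

/-- Starting at `Q` itself makes the first step an increase, since the first difference is a
congruence of a posterior covariance. Monotonicity of the update propagates it. -/
theorem priorCov_le_succ (hQ : Q.PosSemidef) (hR : R.PosDef) (k : ℕ) :
    (priorCov Φ H Q R Q (k + 1) - priorCov Φ H Q R Q k).PosSemidef := by
  induction k with
  | zero =>
    have := posSemidef_conj (covUpdate_posSemidef H hR hQ) Φ
    simpa [priorCov] using this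
  | succ k ih =>
    have := posSemidef_conj (covUpdate_mono H hR (priorCov_posSemidef Φ H hQ hR k)
      (priorCov_posSemidef Φ H hQ hR (k + 1)) ih) Φ
    rw [Matrix.mul_sub, Matrix.sub_mul] at this
    rw [priorCov, priorCov, add_sub_add_right_eq_sub]
    exact this

theorem monotone_priorCov (hQ : Q.PosSemidef) (hR : R.PosDef) (v : ι → ℝ) :
    Monotone fun k => v ⬝ᵥ priorCov Φ H Q R Q k *ᵥ v := by
  refine monotone_nat_of_le_succ fun k => ?_
  have := (priorCov_le_succ Φ H hQ hR k).dotProduct_mulVec_nonneg v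
  rw [star_trivial, Matrix.sub_mulVec, dotProduct_sub] at this
  linarith

/-- Both summands of $\Phi P_{k(+)}\Phi^\top+Q$ are semidefinite, so a null vector `v` is null for
`Q`, and `Φᵀ v` is null for the posterior, hence for the previous prior covariance. Iterating
reaches every power up to `k`. -/
theorem mulVec_transpose_pow_eq_zero_of_priorCov (hQ : Q.PosSemidef) (hR : R.PosDef) (k : ℕ) :
    ∀ v : ι → ℝ, v ⬝ᵥ priorCov Φ H Q R Q k *ᵥ v = 0 →
      ∀ i ≤ k, Q *ᵥ (Φᵀ ^ i *ᵥ v) = 0 := by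
  have key : ∀ v : ι → ℝ, v ⬝ᵥ Q *ᵥ v = 0 → Q *ᵥ v = 0 := fun v h =>
    (hQ.dotProduct_mulVec_zero_iff v).1 (by simpa using h)
  induction k with
  | zero =>
    intro v hv i hi
    obtain rfl : i = 0 := by omega
    simpa using key v hv
  | succ k ih =>
    intro v hv i hi
    rw [priorCov, Matrix.add_mulVec, dotProduct_add, dotProduct_conj_mulVec] at hv
    have h1 : 0 ≤ v ⬝ᵥ Q *ᵥ v := by simpa using hQ.dotProduct_mulVec_nonneg v
    have hP := priorCov_posSemidef Φ H hQ hR k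
    have h2 := (covUpdate_posSemidef H hR hP).dotProduct_mulVec_nonneg (Φᵀ *ᵥ v)
    rw [star_trivial] at h2
    cases i with
    | zero => simpa using key v (by linarith)
    | succ i =>
      have h3 := ih (Φᵀ *ᵥ v) (mulVec_eq_zero_of_covUpdate H hR hP (by linarith)) i (by omega)
      rwa [Matrix.mulVec_mulVec v, ← pow_succ] at h3

theorem priorCov_posDef (hQ : Q.PosSemidef) (hR : R.PosDef) {d : ℕ}
    (hc : ∀ v : ι → ℝ, (∀ i ≤ d, Q *ᵥ (Φᵀ ^ i *ᵥ v) = 0) → v = 0) {k : ℕ} (hk : d ≤ k) :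
    (priorCov Φ H Q R Q k).PosDef := by
  have hP := priorCov_posSemidef Φ H hQ hR k
  refine .of_dotProduct_mulVec_pos hP.1 fun {v} hv => ?_
  refine (hP.dotProduct_mulVec_nonneg v).lt_of_ne fun h => hv (hc v fun i hi => ?_)
  exact mulVec_transpose_pow_eq_zero_of_priorCov Φ H hQ hR k v (by simpa using h.symm) i
    (hi.trans hk)

/-- The minimizing property of the Kalman gain, for a single dual vector `y` and an arbitrary dual
input `w`. -/
theorem dotProduct_covUpdate_le (hR : R.PosDef) {P : Matrix ι ι ℝ} (hP : P.PosSemidef)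
    (y : ι → ℝ) (w : κ → ℝ) :
    y ⬝ᵥ covUpdate H R P *ᵥ y ≤ (y - Hᵀ *ᵥ w) ⬝ᵥ P *ᵥ (y - Hᵀ *ᵥ w) + w ⬝ᵥ R *ᵥ w := by
  by_cases hy : y = 0
  · subst hy
    have h1 := hP.dotProduct_mulVec_nonneg (0 - Hᵀ *ᵥ w)
    have h2 := hR.posSemidef.dotProduct_mulVec_nonneg w
    rw [star_trivial] at h1 h2
    rw [zero_dotProduct]
    exact add_nonneg h1 h2
  · have hyy : y ⬝ᵥ y ≠ 0 := fun h => hy (dotProduct_self_eq_zero.1 h)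
    -- A rank-one gain with `Kᵀ *ᵥ y = w`. It exists only for `y ≠ 0`, hence the case split.
    set K : Matrix ι κ ℝ := (y ⬝ᵥ y)⁻¹ • Matrix.vecMulVec y w with hK
    have hKy : Kᵀ *ᵥ y = w := by
      ext i
      simp [hK, Matrix.transpose_smul, Matrix.smul_mulVec, Matrix.vecMulVec_mulVec,
        Matrix.transpose_vecMulVec]
      field_simp
    have h := (covUpdate_le_josephCov H hR hP K).dotProduct_mulVec_nonneg y
    rw [star_trivial, Matrix.sub_mulVec, dotProduct_sub, josephCov, Matrix.add_mulVec,
      dotProduct_add, dotProduct_conj_mulVec, dotProduct_conj_mulVec, hKy, Matrix.transpose_sub,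
      Matrix.transpose_one, Matrix.transpose_mul, Matrix.sub_mulVec, Matrix.one_mulVec,
      ← Matrix.mulVec_mulVec, hKy] at h
    linarith

/-- Steering the dual system by the inputs `w` bounds the quadratic form of the covariances. -/
theorem priorCov_add_le (hQ : Q.PosSemidef) (hR : R.PosDef) (k j : ℕ) :
    ∀ (w : ℕ → κ → ℝ) (v : ℕ → ι → ℝ), (∀ i, v (i + 1) = Φᵀ *ᵥ v i - Hᵀ *ᵥ w i) →
      v 0 ⬝ᵥ priorCov Φ H Q R Q (k + j) *ᵥ v 0 ≤ v j ⬝ᵥ priorCov Φ H Q R Q k *ᵥ v j +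
        ∑ i ∈ Finset.range j, (w i ⬝ᵥ R *ᵥ w i + v i ⬝ᵥ Q *ᵥ v i) := by
  induction j with
  | zero => simp
  | succ j ih =>
    intro w v hv
    -- The induction peels off the first dual step: the hypothesis is applied to the trajectory
    -- shifted by one.
    have h1 := ih (fun i => w (i + 1)) (fun i => v (i + 1)) fun i => hv (i + 1)
    have h2 := dotProduct_covUpdate_le H hR (priorCov_posSemidef Φ H hQ hR (k + j))
      (Φᵀ *ᵥ v 0) (w 0)
    rw [← hv 0] at h2
    rw [Finset.sum_range_succ', ← add_assoc k j 1, priorCov, Matrix.add_mulVec, dotProduct_add,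
      dotProduct_conj_mulVec]
    simp only [zero_add] at h1
    linarith

/-- Under observability the covariances are bounded. -/
theorem priorCov_bddAbove (hQ : Q.PosSemidef) (hR : R.PosDef) {d : ℕ}
    (ho : ∀ x : ι → ℝ, (∀ i ≤ d, H *ᵥ (Φ ^ i *ᵥ x) = 0) → x = 0) (v : ι → ℝ) :
    BddAbove (Set.range fun k => v ⬝ᵥ priorCov Φ H Q R Q k *ᵥ v) := by
  -- The observability Gramian, invertible by `ho`.
  set M : Matrix ι ι ℝ := ∑ i ∈ Finset.range (d + 1), Φᵀ ^ i * Hᵀ * (H * Φ ^ i) with hM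
  have hinj : Function.Injective M.mulVec := by
    refine (injective_iff_map_eq_zero (Matrix.mulVecLin M)).2 fun x hx => ?_
    rw [Matrix.mulVecLin_apply] at hx
    have hs : ∑ i ∈ Finset.range (d + 1), (H *ᵥ (Φ ^ i *ᵥ x)) ⬝ᵥ (H *ᵥ (Φ ^ i *ᵥ x)) = 0 := by
      have := congrArg (x ⬝ᵥ ·) hx
      simp only [hM, Matrix.sum_mulVec, dotProduct_sum, dotProduct_zero] at this
      rw [← this]
      refine Finset.sum_congr rfl fun i _ => ?_
      rw [← Matrix.transpose_pow, ← Matrix.transpose_mul, ← Matrix.mulVec_mulVec,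
        Matrix.dotProduct_mulVec x, Matrix.vecMul_transpose, Matrix.mulVec_mulVec]
    refine ho x fun i hi => ?_
    have := (Finset.sum_eq_zero_iff_of_nonneg fun i _ =>
      Finset.sum_nonneg fun j _ => mul_self_nonneg _).1 hs i
      (Finset.mem_range.2 (by omega))
    exact dotProduct_self_eq_zero.1 this
  have hu := (Matrix.isUnit_iff_isUnit_det _).1 (Matrix.mulVec_injective_iff_isUnit.1 hinj)
  -- Deadbeat control of the dual system: inverting the Gramian yields inputs, in reversed time
  -- order, that drive `v` to zero in `d + 1` steps. Only the running cost then remains, and it does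
  -- not depend on `k`.
  set y : ι → ℝ := M⁻¹ *ᵥ (Φᵀ ^ (d + 1) *ᵥ v)
  have hy : M *ᵥ y = Φᵀ ^ (d + 1) *ᵥ v := by
    rw [Matrix.mulVec_mulVec, Matrix.mul_nonsing_inv _ hu, Matrix.one_mulVec]
  set w : ℕ → κ → ℝ := fun i => H *ᵥ (Φ ^ (d - i) *ᵥ y) with hw
  obtain ⟨x, hx0, hx1⟩ : ∃ x : ℕ → ι → ℝ, x 0 = v ∧
      ∀ i, x (i + 1) = Φᵀ *ᵥ x i - Hᵀ *ᵥ w i :=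
    ⟨fun j => Nat.rec v (fun i xi => Φᵀ *ᵥ xi - Hᵀ *ᵥ w i) j, rfl, fun _ => rfl⟩
  have hform : ∀ j, x j = Φᵀ ^ j *ᵥ v -
      ∑ i ∈ Finset.range j, Φᵀ ^ (j - 1 - i) *ᵥ (Hᵀ *ᵥ w i) := by
    intro j
    induction j with
    | zero => simp [hx0]
    | succ j ih =>
      rw [hx1, ih, Finset.sum_range_succ, Matrix.mulVec_sub, Matrix.mulVec_mulVec, ← pow_succ',
        Matrix.mulVec_sum, sub_sub]
      congr 2
      · refine Finset.sum_congr rfl fun i hi => ?_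
        have := Finset.mem_range.1 hi
        rw [Matrix.mulVec_mulVec, ← pow_succ', show j - 1 - i + 1 = j + 1 - 1 - i by omega]
      · simp
  have hend : x (d + 1) = 0 := by
    rw [hform, ← hy, sub_eq_zero, hM, Matrix.sum_mulVec, ← Finset.sum_range_reflect]
    refine Finset.sum_congr rfl fun i hi => ?_
    simp only [hw, Matrix.mulVec_mulVec, Matrix.mul_assoc, Nat.add_sub_cancel]
  refine ⟨∑ i ∈ Finset.range (d + 1), (w i ⬝ᵥ R *ᵥ w i + x i ⬝ᵥ Q *ᵥ x i), ?_⟩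
  rintro _ ⟨k, rfl⟩
  have h1 := priorCov_add_le Φ H hQ hR k (d + 1) w x hx1
  rw [hend, hx0, zero_dotProduct, zero_add] at h1
  exact (monotone_priorCov Φ H hQ hR v (Nat.le_add_right k (d + 1))).trans h1

/-- The covariances converge to a positive definite matrix. -/
theorem exists_tendsto_priorCov (hQ : Q.PosSemidef) (hR : R.PosDef) {d : ℕ}
    (ho : ∀ x : ι → ℝ, (∀ i ≤ d, H *ᵥ (Φ ^ i *ᵥ x) = 0) → x = 0)
    (hc : ∀ v : ι → ℝ, (∀ i ≤ d, Q *ᵥ (Φᵀ ^ i *ᵥ v) = 0) → v = 0) :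
    ∃ P : Matrix ι ι ℝ, P.PosDef ∧ Tendsto (priorCov Φ H Q R Q) atTop (𝓝 P) := by
  have hq : ∀ v : ι → ℝ, ∃ l, Tendsto (fun k => v ⬝ᵥ priorCov Φ H Q R Q k *ᵥ v) atTop (𝓝 l) :=
    fun v => ⟨_, tendsto_atTop_ciSup (monotone_priorCov Φ H hQ hR v)
      (priorCov_bddAbove Φ H hQ hR ho v)⟩
  have hsymm : ∀ k, (priorCov Φ H Q R Q k)ᵀ = priorCov Φ H Q R Q k := fun k =>
    transpose_eq_of_posSemidef (priorCov_posSemidef Φ H hQ hR k)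
  -- Polarization recovers the entries from the convergent quadratic forms.
  have hentry : ∀ i j, ∃ l, Tendsto (fun k => priorCov Φ H Q R Q k i j) atTop (𝓝 l) := by
    intro i j
    obtain ⟨a, ha⟩ := hq (Pi.single i 1 + Pi.single j 1)
    obtain ⟨b, hb⟩ := hq (Pi.single i 1)
    obtain ⟨c, hc⟩ := hq (Pi.single j 1)
    refine ⟨(a - b - c) / 2, (((ha.sub hb).sub hc).div_const 2).congr fun k => ?_⟩
    have hij : priorCov Φ H Q R Q k j i = priorCov Φ H Q R Q k i j :=
      congrFun (congrFun (hsymm k) i) j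
    simp only [Matrix.mulVec_add, add_dotProduct, dotProduct_add, Matrix.mulVec_single_one,
      single_one_dotProduct, Matrix.col_apply, hij]
    ring
  choose l hl using hentry
  have hlim : Tendsto (priorCov Φ H Q R Q) atTop (𝓝 (Matrix.of l)) :=
    tendsto_pi_nhds.2 fun i => tendsto_pi_nhds.2 fun j => hl i j
  refine ⟨Matrix.of l, ?_, hlim⟩
  refine .of_dotProduct_mulVec_pos ?_ fun {v} hv => ?_
  · have h1 : Tendsto (fun k => (priorCov Φ H Q R Q k)ᵀ) atTop (𝓝 (Matrix.of l)ᵀ) :=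
      (continuous_id.matrix_transpose.tendsto _).comp hlim
    simp only [hsymm] at h1
    rw [Matrix.IsHermitian, Matrix.conjTranspose_eq_transpose_of_trivial]
    exact tendsto_nhds_unique h1 hlim
  · have h1 : Tendsto (fun k => v ⬝ᵥ priorCov Φ H Q R Q k *ᵥ v) atTop
        (𝓝 (v ⬝ᵥ Matrix.of l *ᵥ v)) :=
      ((continuous_const.dotProduct (continuous_id.matrix_mulVec continuous_const)).tendsto
        _).comp hlim
    have h2 := (priorCov_posDef Φ H hQ hR hc le_rfl).dotProduct_mulVec_pos hv
    rw [star_trivial] at h2 ⊢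
    exact h2.trans_le ((monotone_priorCov Φ H hQ hR v).ge_of_tendsto h1 d)

end Riccati
-- Contractivity of the limiting filter and of its approximants.
section Stability

set_option linter.unusedSectionVars false

open scoped Matrix.Norms.L2Operator

variable {ι κ : Type*} [Fintype ι] [DecidableEq ι] [Fintype κ] [DecidableEq κ]

/-- The norm attains its maximum on the compact unit sphere, which turns pointwise strictness into a
uniform bound. The sphere is empty for the zero space. -/
theorem opNorm_lt_one_of_forall_norm_lt {E : Type*} [NormedAddCommGroup E] [NormedSpace ℝ E]
    [FiniteDimensional ℝ E] (g : E →L[ℝ] E) (hg : ∀ x, x ≠ 0 → ‖g x‖ < ‖x‖) : ‖g‖ < 1 := by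
  rcases (Metric.sphere (0 : E) 1).eq_empty_or_nonempty with h | h
  · refine (ContinuousLinearMap.opNorm_le_of_unit_norm (C := 0) le_rfl fun x hx => ?_).trans_lt
      one_pos
    have : x ∈ Metric.sphere (0 : E) 1 := by simpa using hx
    simp [h] at this
  · obtain ⟨x, hx, hmax⟩ := (isCompact_sphere (0 : E) 1).exists_isMaxOn h
      (g.continuous.norm.continuousOn)
    have hx1 : ‖x‖ = 1 := by simpa using hx
    have hx0 : x ≠ 0 := fun h => by simp [h] at hx1
    refine (ContinuousLinearMap.opNorm_le_of_unit_norm (norm_nonneg _) fun y hy => ?_).trans_lt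
      ((hg x hx0).trans_eq hx1)
    exact hmax (by simpa using hy)

theorem l2_opNorm_lt_one {G : Matrix ι ι ℝ} (hG : ∀ x, x ≠ 0 → (G *ᵥ x) ⬝ᵥ (G *ᵥ x) < x ⬝ᵥ x) :
    ‖G‖ < 1 := by
  rw [Matrix.cstar_norm_def]
  refine opNorm_lt_one_of_forall_norm_lt _ fun x hx => ?_
  rw [← sq_lt_sq₀ (norm_nonneg _) (norm_nonneg _), EuclideanSpace.real_norm_sq_eq,
    EuclideanSpace.real_norm_sq_eq, Matrix.ofLp_toEuclideanCLM]
  simpa [dotProduct, sq] using hG x.ofLp (by simpa using hx)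

/-- A matrix solving a Lyapunov equation with positive definite solution and a right-hand side `N`
for which `(F, N)` is controllable is a strict contraction in suitable coordinates. -/
theorem exists_norm_conj_lt_one {F P N : Matrix ι ι ℝ} (hP : P.PosDef) (hN : N.PosSemidef)
    (h : P = F * P * Fᵀ + N) {d : ℕ}
    (hc : ∀ v : ι → ℝ, (∀ i ≤ d, N *ᵥ (Fᵀ ^ i *ᵥ v) = 0) → v = 0) :
    ∃ T : Matrix ι ι ℝ, IsUnit T.det ∧ ‖T * Fᵀ * T⁻¹‖ < 1 := by
  -- In the form `P` the decrease is governed by `N`, which may be only semidefinite. Summing over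
  -- `d + 1` powers makes it strict: `Y - F * Y * Fᵀ` is the controllability Gramian of `(F, N)`.
  set Y : Matrix ι ι ℝ := ∑ i ∈ Finset.range (d + 1), F ^ i * P * (F ^ i)ᵀ with hY
  have hYpos : Y.PosDef := by
    rw [hY, Finset.sum_range_succ']
    refine Matrix.PosDef.posSemidef_add
      (Matrix.posSemidef_sum _ fun i _ => posSemidef_conj hP.posSemidef _) ?_
    simpa using hP
  have hdiff : Y - F * Y * Fᵀ = ∑ i ∈ Finset.range (d + 1), F ^ i * N * (F ^ i)ᵀ := by
    rw [hY, Matrix.mul_sum, Matrix.sum_mul, ← Finset.sum_sub_distrib]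
    refine Finset.sum_congr rfl fun i _ => ?_
    have hN' : N = P - F * P * Fᵀ := by
      rw [eq_sub_iff_add_eq, add_comm]
      exact h.symm
    rw [hN', Matrix.mul_sub, Matrix.sub_mul]
    congr 1
    rw [Matrix.transpose_pow]
    simp only [← Matrix.mul_assoc]
    rw [← pow_succ, ← pow_succ', Matrix.mul_assoc _ Fᵀ, ← pow_succ', Matrix.mul_assoc _ _ Fᵀ,
      ← pow_succ]
  have hlt : ∀ v : ι → ℝ, v ≠ 0 → (Fᵀ *ᵥ v) ⬝ᵥ Y *ᵥ (Fᵀ *ᵥ v) < v ⬝ᵥ Y *ᵥ v := by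
    intro v hv
    rw [← dotProduct_conj_mulVec, ← sub_pos, ← dotProduct_sub, ← Matrix.sub_mulVec, hdiff,
      Matrix.sum_mulVec, dotProduct_sum]
    have h0 : ∀ i, 0 ≤ v ⬝ᵥ (F ^ i * N * (F ^ i)ᵀ) *ᵥ v := fun i => by
      have := (posSemidef_conj hN (F ^ i)).dotProduct_mulVec_nonneg v
      rwa [star_trivial] at this
    refine (Finset.sum_nonneg fun i _ => h0 i).lt_of_ne fun hs => hv (hc v fun i hi => ?_)
    have := (Finset.sum_eq_zero_iff_of_nonneg fun i _ => h0 i).1 hs.symm i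
      (Finset.mem_range.2 (by omega))
    rw [dotProduct_conj_mulVec, Matrix.transpose_pow] at this
    refine (hN.dotProduct_mulVec_zero_iff _).1 ?_
    rwa [star_trivial]
  -- Factoring `Y` turns its quadratic form into the Euclidean norm of `T *ᵥ v`.
  obtain ⟨T, hT⟩ : ∃ T : Matrix ι ι ℝ, Y = Tᵀ * T := by
    open scoped MatrixOrder in
    obtain ⟨T, hT⟩ := CStarAlgebra.nonneg_iff_eq_star_mul_self.1
      (Matrix.nonneg_iff_posSemidef.2 hYpos.posSemidef)
    exact ⟨T, by rw [hT, Matrix.star_eq_conjTranspose,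
      Matrix.conjTranspose_eq_transpose_of_trivial]⟩
  have hTu : IsUnit T.det := by
    have := hYpos.det_pos.ne'
    rw [hT, Matrix.det_mul] at this
    exact (right_ne_zero_of_mul this).isUnit
  have hTv : ∀ v : ι → ℝ, (T *ᵥ v) ⬝ᵥ (T *ᵥ v) = v ⬝ᵥ Y *ᵥ v := fun v => by
    rw [hT, ← Matrix.mulVec_mulVec, Matrix.dotProduct_mulVec v, Matrix.vecMul_transpose]
  refine ⟨T, hTu, l2_opNorm_lt_one fun x hx => ?_⟩
  have hxT : T *ᵥ (T⁻¹ *ᵥ x) = x := by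
    rw [Matrix.mulVec_mulVec, Matrix.mul_nonsing_inv _ hTu, Matrix.one_mulVec]
  have hne : T⁻¹ *ᵥ x ≠ 0 := fun h0 => hx (by rw [← hxT, h0, Matrix.mulVec_zero])
  have := hlt _ hne
  rwa [← hTv, ← hTv, hxT, Matrix.mulVec_mulVec, Matrix.mulVec_mulVec] at this

/-- The transition matrix of the prior estimate. -/
noncomputable def filterMatrix (Φ : Matrix ι ι ℝ) (H : Matrix κ ι ℝ) (R : Matrix κ κ ℝ) (P : Matrix ι ι ℝ) :
    Matrix ι ι ℝ :=
  Φ * (1 - kalmanGain H R P * H)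

variable (Φ : Matrix ι ι ℝ) (H : Matrix κ ι ℝ) {Q : Matrix ι ι ℝ} {R : Matrix κ κ ℝ}

theorem filterMatrix_lyapunov (hR : R.PosDef) {P : Matrix ι ι ℝ} (hP : P.PosSemidef) :
    Φ * covUpdate H R P * Φᵀ = filterMatrix Φ H R P * P * (filterMatrix Φ H R P)ᵀ +
      Φ * kalmanGain H R P * R * (Φ * kalmanGain H R P)ᵀ := by
  rw [covUpdate_eq_josephCov H hR hP, josephCov, filterMatrix, Matrix.mul_add, Matrix.add_mul,
    Matrix.transpose_mul Φ, Matrix.transpose_mul Φ]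
  simp only [Matrix.mul_assoc]

/-- At a positive definite fixed point of the Riccati recursion, the filter is a strict contraction
in suitable coordinates. -/
theorem exists_norm_filterMatrix_lt_one (hQ : Q.PosSemidef) (hR : R.PosDef) {P : Matrix ι ι ℝ}
    (hP : P.PosDef) (hfix : P = Φ * covUpdate H R P * Φᵀ + Q) {d : ℕ}
    (hc : ∀ v : ι → ℝ, (∀ i ≤ d, Q *ᵥ (Φᵀ ^ i *ᵥ v) = 0) → v = 0) :
    ∃ T : Matrix ι ι ℝ, IsUnit T.det ∧ ‖T * (filterMatrix Φ H R P)ᵀ * T⁻¹‖ < 1 := by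
  set K := kalmanGain H R P with hK
  have hKR := posSemidef_conj hR.posSemidef (Φ * K)
  rw [filterMatrix_lyapunov Φ H hR hP.posSemidef, add_assoc] at hfix
  refine exists_norm_conj_lt_one hP (hKR.add hQ) hfix (d := d) fun v hv => hc v ?_
  -- On the kernel of the total noise the feedback term vanishes, so `Fᵀ` acts there as `Φᵀ`.
  -- Controllability of the closed loop thus reduces to that of `(Φ, Q)`.
  have hker : ∀ y : ι → ℝ, (Φ * K * R * (Φ * K)ᵀ + Q) *ᵥ y = 0 →
      Q *ᵥ y = 0 ∧ (filterMatrix Φ H R P)ᵀ *ᵥ y = Φᵀ *ᵥ y := by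
    intro y hy
    have h0 := congrArg (y ⬝ᵥ ·) hy
    simp only [Matrix.add_mulVec, dotProduct_add, dotProduct_zero] at h0
    have h1 := hKR.dotProduct_mulVec_nonneg y
    have h2 := hQ.dotProduct_mulVec_nonneg y
    rw [star_trivial] at h1 h2
    refine ⟨(hQ.dotProduct_mulVec_zero_iff y).1 (by rw [star_trivial]; linarith), ?_⟩
    have h3 : (Φ * K)ᵀ *ᵥ y = 0 := by
      by_contra hne
      have := hR.dotProduct_mulVec_pos hne
      rw [star_trivial, ← dotProduct_conj_mulVec] at this
      linarith
    rw [filterMatrix, ← hK, Matrix.mul_sub, Matrix.mul_one, ← Matrix.mul_assoc,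
      Matrix.transpose_sub, Matrix.transpose_mul (Φ * K), Matrix.sub_mulVec,
      ← Matrix.mulVec_mulVec, h3, Matrix.mulVec_zero, sub_zero]
  have hpow : ∀ i ≤ d, (filterMatrix Φ H R P)ᵀ ^ i *ᵥ v = Φᵀ ^ i *ᵥ v := by
    intro i
    induction i with
    | zero => simp
    | succ i ih =>
      intro hi
      rw [pow_succ', pow_succ', ← Matrix.mulVec_mulVec, (hker _ (hv i (by omega))).2,
        ih (by omega), Matrix.mulVec_mulVec]
  intro i hi
  rw [← hpow i hi]
  exact (hker _ (hv i hi)).1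

theorem tendsto_inv {M : ℕ → Matrix κ κ ℝ} {M' : Matrix κ κ ℝ} (h : Tendsto M atTop (𝓝 M'))
    (hM : IsUnit M'.det) : Tendsto (fun k => (M k)⁻¹) atTop (𝓝 M'⁻¹) := by
  refine (continuousAt_matrix_inv M' ?_).tendsto.comp h
  rw [Ring.inverse_eq_inv']
  exact continuousAt_inv₀ hM.ne_zero

theorem tendsto_innovationCov {P : ℕ → Matrix ι ι ℝ} {P' : Matrix ι ι ℝ}
    (h : Tendsto P atTop (𝓝 P')) :
    Tendsto (fun k => H * P k * Hᵀ + R) atTop (𝓝 (H * P' * Hᵀ + R)) :=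
  (((continuous_const.matrix_mul continuous_id).matrix_mul continuous_const).add
    continuous_const).tendsto P' |>.comp h

theorem tendsto_innovationCov_inv (hR : R.PosDef) {P : ℕ → Matrix ι ι ℝ} {P' : Matrix ι ι ℝ}
    (hP' : P'.PosSemidef) (h : Tendsto P atTop (𝓝 P')) :
    Tendsto (fun k => (H * P k * Hᵀ + R)⁻¹) atTop (𝓝 (H * P' * Hᵀ + R)⁻¹) :=
  tendsto_inv (tendsto_innovationCov H h)
    ((Matrix.isUnit_iff_isUnit_det _).1 (innovationCov_posDef H hR hP').isUnit)

theorem tendsto_matrix_mul {α β γ : Type*} [Fintype β] {M : ℕ → Matrix α β ℝ}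
    {N : ℕ → Matrix β γ ℝ} {M' : Matrix α β ℝ} {N' : Matrix β γ ℝ} (hM : Tendsto M atTop (𝓝 M'))
    (hN : Tendsto N atTop (𝓝 N')) : Tendsto (fun k => M k * N k) atTop (𝓝 (M' * N')) :=
  ((continuous_fst.matrix_mul continuous_snd).tendsto (M', N')).comp (hM.prodMk_nhds hN)

theorem tendsto_kalmanGain (hR : R.PosDef) {P : ℕ → Matrix ι ι ℝ} {P' : Matrix ι ι ℝ}
    (hP' : P'.PosSemidef) (h : Tendsto P atTop (𝓝 P')) :
    Tendsto (fun k => kalmanGain H R (P k)) atTop (𝓝 (kalmanGain H R P')) :=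
  tendsto_matrix_mul (tendsto_matrix_mul h tendsto_const_nhds)
    (tendsto_innovationCov_inv H hR hP' h)

theorem tendsto_filterMatrix (hR : R.PosDef) {P : ℕ → Matrix ι ι ℝ} {P' : Matrix ι ι ℝ}
    (hP' : P'.PosSemidef) (h : Tendsto P atTop (𝓝 P')) :
    Tendsto (fun k => filterMatrix Φ H R (P k)) atTop (𝓝 (filterMatrix Φ H R P')) :=
  tendsto_matrix_mul tendsto_const_nhds (tendsto_const_nhds.sub
    (tendsto_matrix_mul (tendsto_kalmanGain H hR hP' h) tendsto_const_nhds))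

theorem tendsto_covUpdate (hR : R.PosDef) {P : ℕ → Matrix ι ι ℝ} {P' : Matrix ι ι ℝ}
    (hP' : P'.PosSemidef) (h : Tendsto P atTop (𝓝 P')) :
    Tendsto (fun k => covUpdate H R (P k)) atTop (𝓝 (covUpdate H R P')) :=
  tendsto_matrix_mul (tendsto_const_nhds.sub
    (tendsto_matrix_mul (tendsto_kalmanGain H hR hP' h) tendsto_const_nhds)) h

/-- In suitable coordinates, the filter matrices are eventually uniform strict contractions. -/
theorem exists_eventually_contraction (hQ : Q.PosSemidef) (hR : R.PosDef) {d : ℕ}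
    (hc : ∀ v : ι → ℝ, (∀ i ≤ d, Q *ᵥ (Φᵀ ^ i *ᵥ v) = 0) → v = 0) {P : Matrix ι ι ℝ}
    (hP : P.PosDef) (hlim : Tendsto (priorCov Φ H Q R Q) atTop (𝓝 P)) :
    ∃ T : Matrix ι ι ℝ, IsUnit T.det ∧ ∃ q : ℝ, 0 ≤ q ∧ q < 1 ∧ ∀ᶠ k in atTop,
      ‖T * (filterMatrix Φ H R (priorCov Φ H Q R Q k))ᵀ * T⁻¹‖ ≤ q := by
  -- The limit solves the algebraic Riccati equation, by continuity of the update.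
  have hfix : P = Φ * covUpdate H R P * Φᵀ + Q :=
    tendsto_nhds_unique (hlim.comp (tendsto_add_atTop_nat 1))
      ((tendsto_matrix_mul (tendsto_matrix_mul tendsto_const_nhds
        (tendsto_covUpdate H hR hP.posSemidef hlim)) tendsto_const_nhds).add tendsto_const_nhds)
  obtain ⟨T, hT, hlt⟩ := exists_norm_filterMatrix_lt_one Φ H hQ hR hP hfix hc
  obtain ⟨q, hq1, hq2⟩ := exists_between hlt
  refine ⟨T, hT, q, (norm_nonneg _).trans hq1.le, hq2, ?_⟩
  have h1 := (tendsto_matrix_mul (tendsto_matrix_mul (tendsto_const_nhds (x := T))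
    ((continuous_id.matrix_transpose.tendsto _).comp
      (tendsto_filterMatrix Φ H hR hP.posSemidef hlim))) (tendsto_const_nhds (x := T⁻¹))).norm
  exact (h1.eventually_lt_const hq1).mono fun k hk => hk.le

end Stability
-- Scalar recursions: linear growth and geometric decay.
section Sequences

theorem exists_forall_le_mul_of_eventually {b : ℕ → ℝ} {q C : ℝ} (hq0 : 0 ≤ q) (hq : q < 1)
    (h : ∀ᶠ k in atTop, b (k + 1) ≤ q * b k + C * (k + 1)) :
    ∃ D, 0 ≤ D ∧ ∀ᶠ k : ℕ in atTop, b k ≤ D * (k + 1) := by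
  obtain ⟨k₀, hk⟩ := eventually_atTop.1 h
  have hq' : 0 < 1 - q := by linarith
  -- With `C ≤ D * (1 - q)`, the sequence `D * (k + 1)` is a supersolution of the recursion; the
  -- other terms handle the start and the sign.
  set D := max (max (b k₀) 0) (C / (1 - q)) with hD
  have hD0 : 0 ≤ D := (le_max_right _ _).trans (le_max_left _ _)
  have hDC : C ≤ D * (1 - q) := (div_le_iff₀ hq').1 (le_max_right _ _)
  refine ⟨D, hD0, eventually_atTop.2 ⟨k₀, fun k hk₀ => ?_⟩⟩
  induction k, hk₀ using Nat.le_induction with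
  | base =>
    have h1 : b k₀ ≤ D := (le_max_left _ _).trans (le_max_left _ _)
    have : (0 : ℝ) ≤ k₀ := Nat.cast_nonneg _
    nlinarith
  | succ k hk₀ ih =>
    have h1 := hk k hk₀
    have hk0 : (0 : ℝ) ≤ k := Nat.cast_nonneg _
    push_cast
    nlinarith [mul_le_mul_of_nonneg_left ih hq0]

/-- Geometric decay beats linear growth; the factor `k + 1` will absorb the growth of the
innovations. -/
theorem tendsto_mul_of_eventually_le {a : ℕ → ℝ} {q : ℝ} (ha : ∀ k, 0 ≤ a k) (hq0 : 0 ≤ q)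
    (hq : q < 1) (h : ∀ᶠ k in atTop, a (k + 1) ≤ q * a k) :
    Tendsto (fun k : ℕ => a k * (k + 1)) atTop (𝓝 0) := by
  obtain ⟨k₀, hk⟩ := eventually_atTop.1 h
  have hbound : ∀ j, a (j + k₀) ≤ q ^ j * a k₀ := by
    intro j
    induction j with
    | zero => simp
    | succ j ih =>
      rw [show j + 1 + k₀ = j + k₀ + 1 by omega, pow_succ', mul_assoc]
      exact (hk _ (by omega)).trans (mul_le_mul_of_nonneg_left ih hq0)
  rw [← tendsto_add_atTop_iff_nat k₀]
  have h1 := tendsto_self_mul_const_pow_of_lt_one hq0 hq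
  have h2 := tendsto_pow_atTop_nhds_zero_of_lt_one hq0 hq
  have h3 := (h1.add (h2.mul_const ((k₀ : ℝ) + 1))).const_mul (a k₀)
  simp only [zero_mul, add_zero, mul_zero] at h3
  refine squeeze_zero (fun k => mul_nonneg (ha _) (by positivity)) (fun k => ?_) h3
  calc a (k + k₀) * (((k + k₀ : ℕ) : ℝ) + 1) ≤ q ^ k * a k₀ * (((k + k₀ : ℕ) : ℝ) + 1) :=
        mul_le_mul_of_nonneg_right (hbound k) (by positivity)
    _ = _ := by push_cast; ring

end Sequences

/-! ### Decay of the accumulated smoother gains. -/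

section Smoother

set_option linter.unusedSectionVars false

open scoped Matrix.Norms.L2Operator

variable {ι κ α : Type*} [Fintype ι] [DecidableEq ι] [Fintype κ] [DecidableEq κ] [Fintype α]

variable (Φ : Matrix ι ι ℝ) (H : Matrix κ ι ℝ) {Q : Matrix ι ι ℝ} {R : Matrix κ κ ℝ}

/-- Although the prior covariance `P_{k+1(-)}` may be singular, the smoother gain solves
`L_k P_{k+1(-)} = P_{k(-)} F_kᵀ`. -/
theorem smootherGain_mul_priorCov (hQ : Q.PosSemidef) (hR : R.PosDef) (k : ℕ) :
    smootherGain Φ H Q R Q k * priorCov Φ H Q R Q (k + 1) =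
      priorCov Φ H Q R Q k * (filterMatrix Φ H R (priorCov Φ H Q R Q k))ᵀ := by
  have hP := priorCov_posSemidef Φ H hQ hR k
  have hC := covUpdate_posSemidef H hR hP
  have hPF : priorCov Φ H Q R Q k * (filterMatrix Φ H R (priorCov Φ H Q R Q k))ᵀ =
      postCov Φ H Q R Q k * Φᵀ := by
    rw [filterMatrix, Matrix.transpose_mul, ← Matrix.mul_assoc, postCov,
      ← transpose_eq_of_posSemidef hC, covUpdate, Matrix.transpose_mul,
      transpose_eq_of_posSemidef hP]
  rw [hPF, smootherGain, Matrix.mul_assoc _ (pinv _)]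
  set N := priorCov Φ H Q R Q (k + 1) with hN
  have hNe : N * (pinv N * N) = N := by
    rw [← Matrix.mul_assoc]
    exact (pinv_penrose N).1
  -- The kernel of $P_{k+1(-)}$ lies in that of $P_{k(+)}\Phi^\top$. The columns of `1 - pinv N * N`
  -- lie in the former, so the pseudo-inverse cancels as an inverse would.
  have hker : ∀ u : ι → ℝ, N *ᵥ u = 0 → (postCov Φ H Q R Q k * Φᵀ) *ᵥ u = 0 := by
    intro u hu
    have h0 := congrArg (u ⬝ᵥ ·) hu
    simp only [hN, priorCov, Matrix.add_mulVec, dotProduct_add, dotProduct_zero] at h0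
    rw [dotProduct_conj_mulVec] at h0
    have h1 := hC.dotProduct_mulVec_nonneg (Φᵀ *ᵥ u)
    have h2 := hQ.dotProduct_mulVec_nonneg u
    rw [star_trivial] at h1 h2
    rw [← Matrix.mulVec_mulVec]
    exact (hC.dotProduct_mulVec_zero_iff _).1 (by rw [star_trivial]; linarith)
  refine Matrix.ext_of_mulVec_single fun i => ?_
  rw [← sub_eq_zero, ← neg_eq_zero, neg_sub, ← Matrix.mulVec_mulVec (Pi.single i 1) _ (_ * _),
    ← Matrix.mulVec_sub]
  refine hker _ ?_
  rw [Matrix.mulVec_sub, Matrix.mulVec_mulVec, hNe, sub_self]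

/-- The accumulated gain, multiplied by the covariance, propagates by the transposed filter. -/
theorem gain_mul_priorCov_succ (hQ : Q.PosSemidef) (hR : R.PosDef) {Γ : ℕ → Matrix α ι ℝ}
    (hΓ : ∀ k, Γ (k + 1) = Γ k * smootherGain Φ H Q R Q k) (k : ℕ) :
    Γ (k + 1) * priorCov Φ H Q R Q (k + 1) = Γ k * priorCov Φ H Q R Q k *
      (filterMatrix Φ H R (priorCov Φ H Q R Q k))ᵀ := by
  rw [hΓ, Matrix.mul_assoc, smootherGain_mul_priorCov Φ H hQ hR, Matrix.mul_assoc]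

/-- Extending the horizon by one step changes the smoothed estimate by the accumulated gain applied
to the last update. -/
theorem gain_mulVec_smoothedState_sub {P₀ : Matrix ι ι ℝ} {Γ : ℕ → Matrix α ι ℝ}
    (hΓ : ∀ k, Γ (k + 1) = Γ k * smootherGain Φ H Q R P₀ k) (χ₀ : ι → ℝ) (z : ℕ → κ → ℝ) (j : ℕ) :
    ∀ k, Γ k *ᵥ (smoothedState Φ H Q R P₀ χ₀ z (j + 1) k - smoothedState Φ H Q R P₀ χ₀ z j k) =
      Γ (k + j + 1) *ᵥ (postState Φ H Q R P₀ χ₀ z (k + j + 1) -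
        priorState Φ H Q R P₀ χ₀ z (k + j + 1)) := by
  induction j with
  | zero =>
    intro k
    simp only [smoothedState]
    rw [add_sub_cancel_left, Matrix.mulVec_mulVec, ← hΓ, add_zero]
  | succ j ih =>
    intro k
    have hrec : ∀ i, smoothedState Φ H Q R P₀ χ₀ z (i + 1) k = postState Φ H Q R P₀ χ₀ z k +
        smootherGain Φ H Q R P₀ k *ᵥ (smoothedState Φ H Q R P₀ χ₀ z i (k + 1) -
          priorState Φ H Q R P₀ χ₀ z (k + 1)) := fun _ => rfl
    rw [hrec, hrec, add_sub_add_left_eq_sub, ← Matrix.mulVec_sub,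
      sub_sub_sub_cancel_right, Matrix.mulVec_mulVec, ← hΓ, ih (k + 1),
      show k + 1 + j + 1 = k + (j + 1) + 1 by omega]

theorem postState_sub_priorState {P₀ : Matrix ι ι ℝ} (χ₀ : ι → ℝ) (z : ℕ → κ → ℝ) (k : ℕ) :
    postState Φ H Q R P₀ χ₀ z k - priorState Φ H Q R P₀ χ₀ z k =
      kalmanGain H R (priorCov Φ H Q R P₀ k) *ᵥ (z k - H *ᵥ priorState Φ H Q R P₀ χ₀ z k) := by
  rw [postState, stateUpdate, add_sub_cancel_left]

theorem priorState_succ {P₀ : Matrix ι ι ℝ} (χ₀ : ι → ℝ) (z : ℕ → κ → ℝ) (k : ℕ) :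
    priorState Φ H Q R P₀ χ₀ z (k + 1) =
      filterMatrix Φ H R (priorCov Φ H Q R P₀ k) *ᵥ priorState Φ H Q R P₀ χ₀ z k +
        (Φ * kalmanGain H R (priorCov Φ H Q R P₀ k)) *ᵥ z k := by
  rw [priorState, stateUpdate, filterMatrix, ← Matrix.mulVec_mulVec, ← Matrix.mulVec_mulVec,
    ← Matrix.mulVec_add, Matrix.sub_mulVec, Matrix.one_mulVec, Matrix.mulVec_sub,
    ← Matrix.mulVec_mulVec]
  congr 1
  abel

theorem norm_toLp_mulVec_le {β : Type*} [Fintype β] [DecidableEq β] (M : Matrix α β ℝ) (v : β → ℝ) :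
    ‖WithLp.toLp 2 (M *ᵥ v)‖ ≤ ‖M‖ * ‖WithLp.toLp 2 v‖ :=
  Matrix.l2_opNorm_mulVec M (WithLp.toLp 2 v)

theorem exists_norm_le_of_lipschitz {E : Type*} [NormedAddCommGroup E] {z : ℕ → E} {ℓ : ℝ}
    (hz : ∀ k, ‖z (k + 1) - z k‖ ≤ ℓ) : ∃ Z, 0 ≤ Z ∧ ∀ k : ℕ, ‖z k‖ ≤ Z * (k + 1) := by
  have hℓ : 0 ≤ ℓ := (norm_nonneg _).trans (hz 0)
  refine ⟨‖z 0‖ + ℓ, by positivity, fun k => ?_⟩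
  induction k with
  | zero => simpa using hℓ
  | succ k ih =>
    have h1 := norm_add_le (z (k + 1) - z k) (z k)
    rw [sub_add_cancel] at h1
    have h2 := hz k
    have h3 := norm_nonneg (z 0)
    push_cast
    nlinarith

theorem eventually_norm_le_of_tendsto {E : Type*} [SeminormedAddCommGroup E] {f : ℕ → E} {l : E}
    (h : Tendsto f atTop (𝓝 l)) : ∀ᶠ k in atTop, ‖f k‖ ≤ ‖l‖ + 1 :=
  (h.norm.eventually_lt_const (lt_add_one _)).mono fun _ hk => hk.le

/-- For a stable filter and a reference of at most linear growth, the prior estimates grow at most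
linearly. -/
theorem exists_norm_priorState_le (hR : R.PosDef) {P : Matrix ι ι ℝ} (hP : P.PosDef)
    (hlim : Tendsto (priorCov Φ H Q R Q) atTop (𝓝 P)) {T : Matrix ι ι ℝ} (hT : IsUnit T.det)
    {q : ℝ} (hq0 : 0 ≤ q) (hq : q < 1)
    (hcontr : ∀ᶠ k in atTop, ‖T * (filterMatrix Φ H R (priorCov Φ H Q R Q k))ᵀ * T⁻¹‖ ≤ q)
    (χ₀ : ι → ℝ) {z : ℕ → κ → ℝ} {Z : ℝ} (hz : ∀ k : ℕ, ‖WithLp.toLp 2 (z k)‖ ≤ Z * (k + 1)) :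
    ∃ D, 0 ≤ D ∧ ∀ᶠ k : ℕ in atTop,
      ‖WithLp.toLp 2 (priorState Φ H Q R Q χ₀ z k)‖ ≤ D * (k + 1) := by
  have hgain := eventually_norm_le_of_tendsto (tendsto_matrix_mul
    (tendsto_const_nhds (x := (T⁻¹)ᵀ)) (tendsto_matrix_mul (tendsto_const_nhds (x := Φ))
      (tendsto_kalmanGain H hR hP.posSemidef hlim)))
  set c := ‖(T⁻¹)ᵀ * (Φ * kalmanGain H R P)‖ + 1
  have hback : ∀ v : ι → ℝ, Tᵀ *ᵥ ((T⁻¹)ᵀ *ᵥ v) = v := fun v => by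
    rw [Matrix.mulVec_mulVec, ← Matrix.transpose_mul, Matrix.nonsing_inv_mul _ hT,
      Matrix.transpose_one, Matrix.one_mulVec]
  -- The contraction is known for `T * Fᵀ * T⁻¹`. Its transpose, of equal norm, is `F` in the
  -- coordinates `(T⁻¹)ᵀ`, so the estimates are measured there.
  obtain ⟨D, hD0, hD⟩ := exists_forall_le_mul_of_eventually hq0 hq (C := c * Z)
    (b := fun k => ‖WithLp.toLp 2 ((T⁻¹)ᵀ *ᵥ priorState Φ H Q R Q χ₀ z k)‖) (by
      filter_upwards [hcontr, hgain] with k h1 h2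
      set F := filterMatrix Φ H R (priorCov Φ H Q R Q k)
      have e : (T⁻¹)ᵀ *ᵥ priorState Φ H Q R Q χ₀ z (k + 1) =
          (T * Fᵀ * T⁻¹)ᵀ *ᵥ ((T⁻¹)ᵀ *ᵥ priorState Φ H Q R Q χ₀ z k) +
          ((T⁻¹)ᵀ * (Φ * kalmanGain H R (priorCov Φ H Q R Q k))) *ᵥ z k := by
        rw [priorState_succ, Matrix.mulVec_add, Matrix.mulVec_mulVec (z k), Matrix.transpose_mul,
          Matrix.transpose_mul, Matrix.transpose_transpose,
          ← Matrix.mulVec_mulVec _ _ (F * Tᵀ), ← Matrix.mulVec_mulVec _ F, hback]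
      rw [e, WithLp.toLp_add]
      refine (norm_add_le _ _).trans (add_le_add ((norm_toLp_mulVec_le _ _).trans ?_)
        ((norm_toLp_mulVec_le _ _).trans ?_))
      · refine mul_le_mul_of_nonneg_right ?_ (norm_nonneg _)
        rwa [← Matrix.conjTranspose_eq_transpose_of_trivial, Matrix.l2_opNorm_conjTranspose]
      · rw [mul_assoc]
        exact mul_le_mul h2 (hz k) (norm_nonneg _) (by positivity))
  refine ⟨‖Tᵀ‖ * D, by positivity, hD.mono fun k hk => ?_⟩
  have := norm_toLp_mulVec_le Tᵀ ((T⁻¹)ᵀ *ᵥ priorState Φ H Q R Q χ₀ z k)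
  rw [hback] at this
  rw [mul_assoc]
  exact this.trans (mul_le_mul_of_nonneg_left hk (norm_nonneg _))

/-- Convergence of fixed-point smoothing: the accumulated smoother gains tend to zero, and so do the
changes of the smoothed estimate when the horizon is extended, for Lipschitz measurements. -/
theorem tendsto_smoother (hQ : Q.PosSemidef) (hR : R.PosDef) {d : ℕ}
    (ho : ∀ x : ι → ℝ, (∀ i ≤ d, H *ᵥ (Φ ^ i *ᵥ x) = 0) → x = 0)
    (hc : ∀ v : ι → ℝ, (∀ i ≤ d, Q *ᵥ (Φᵀ ^ i *ᵥ v) = 0) → v = 0) {Γ : ℕ → Matrix α ι ℝ}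
    (hΓ : ∀ k, Γ (k + 1) = Γ k * smootherGain Φ H Q R Q k) (χ₀ : ι → ℝ) {z : ℕ → κ → ℝ} {ℓ : ℝ}
    (hz : ∀ k, ‖WithLp.toLp 2 (z (k + 1) - z k)‖ ≤ ℓ) :
    Tendsto Γ atTop (𝓝 0) ∧
    Tendsto (fun N => ‖WithLp.toLp 2 (Γ 0 *ᵥ (smoothedState Φ H Q R Q χ₀ z (N + 1) 0 -
      smoothedState Φ H Q R Q χ₀ z N 0))‖) atTop (𝓝 0) := by
  obtain ⟨P, hP, hlim⟩ := exists_tendsto_priorCov Φ H hQ hR ho hc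
  obtain ⟨T, hT, q, hq0, hq, hcontr⟩ := exists_eventually_contraction Φ H hQ hR hc hP hlim
  set Θ : ℕ → Matrix α ι ℝ := fun k => Γ k * priorCov Φ H Q R Q k with hΘ
  have hTT : ∀ M : Matrix α ι ℝ, M * T⁻¹ * T = M := fun M => by
    rw [Matrix.mul_assoc, Matrix.nonsing_inv_mul _ hT, Matrix.mul_one]
  have hdecay : ∀ᶠ k in atTop, ‖Θ (k + 1) * T⁻¹‖ ≤ q * ‖Θ k * T⁻¹‖ := by
    filter_upwards [hcontr] with k hk
    have e : Θ (k + 1) * T⁻¹ =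
        Θ k * T⁻¹ * (T * (filterMatrix Φ H R (priorCov Φ H Q R Q k))ᵀ * T⁻¹) := by
      rw [Matrix.mul_assoc T, ← Matrix.mul_assoc _ T, hTT, ← Matrix.mul_assoc]
      exact congrArg (· * T⁻¹) (gain_mul_priorCov_succ Φ H hQ hR hΓ k)
    rw [e, mul_comm q]
    exact (Matrix.l2_opNorm_mul _ _).trans (mul_le_mul_of_nonneg_left hk (norm_nonneg _))
  have hΘlim := tendsto_mul_of_eventually_le (fun k => norm_nonneg (Θ k * T⁻¹)) hq0 hq hdecay
  constructor
  · have h1 : Tendsto (fun k => Θ k * T⁻¹) atTop (𝓝 0) := by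
      refine squeeze_zero_norm (fun k => ?_) hΘlim
      exact le_mul_of_one_le_right (norm_nonneg _) (by simp)
    have h2 := tendsto_matrix_mul (tendsto_matrix_mul h1 (tendsto_const_nhds (x := T)))
      (tendsto_inv hlim ((Matrix.isUnit_iff_isUnit_det _).1 hP.isUnit))
    rw [Matrix.zero_mul, Matrix.zero_mul] at h2
    refine h2.congr' ?_
    -- The covariances are known to be invertible only from index `d` on.
    filter_upwards [eventually_ge_atTop d] with k hk
    rw [hTT, hΘ, Matrix.mul_assoc, Matrix.mul_nonsing_inv _ ((Matrix.isUnit_iff_isUnit_det _).1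
      (priorCov_posDef Φ H hQ hR hc hk).isUnit), Matrix.mul_one]
  · obtain ⟨Z, hZ0, hZ⟩ := exists_norm_le_of_lipschitz
      (z := fun k => (WithLp.toLp 2 (z k) : EuclideanSpace ℝ κ)) (ℓ := ℓ)
      (fun k => by rw [← WithLp.toLp_sub]; exact hz k)
    obtain ⟨D, hD0, hD⟩ := exists_norm_priorState_le Φ H hR hP hlim hT hq0 hq hcontr χ₀ hZ
    have hgain := eventually_norm_le_of_tendsto (tendsto_matrix_mul
      (tendsto_const_nhds (x := T * Hᵀ)) (tendsto_innovationCov_inv H hR hP.posSemidef hlim))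
    set c := ‖T * Hᵀ * (H * P * Hᵀ + R)⁻¹‖ + 1
    have hmain : ∀ᶠ k : ℕ in atTop, ‖WithLp.toLp 2 (Γ k *ᵥ (postState Φ H Q R Q χ₀ z k -
        priorState Φ H Q R Q χ₀ z k))‖ ≤ ‖Θ k * T⁻¹‖ * (k + 1) * (c * (Z + ‖H‖ * D)) := by
      filter_upwards [hD, hgain] with k h1 h2
      -- The leading covariance of the Kalman gain combines with `Γ k` into `Θ k`.
      have e : Γ k *ᵥ (postState Φ H Q R Q χ₀ z k - priorState Φ H Q R Q χ₀ z k) =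
          (Θ k * T⁻¹) *ᵥ ((T * Hᵀ * (H * priorCov Φ H Q R Q k * Hᵀ + R)⁻¹) *ᵥ
            (z k - H *ᵥ priorState Φ H Q R Q χ₀ z k)) := by
        rw [postState_sub_priorState, Matrix.mulVec_mulVec, Matrix.mulVec_mulVec _ (Θ k * T⁻¹),
          Matrix.mul_assoc T, ← Matrix.mul_assoc _ T, hTT, kalmanGain]
        simp only [hΘ, Matrix.mul_assoc]
      have h3 : ‖WithLp.toLp 2 (z k - H *ᵥ priorState Φ H Q R Q χ₀ z k)‖ ≤
          (Z + ‖H‖ * D) * (k + 1) := by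
        rw [WithLp.toLp_sub, add_mul, mul_assoc]
        exact (norm_sub_le _ _).trans (add_le_add (hZ k) ((norm_toLp_mulVec_le _ _).trans
          (mul_le_mul_of_nonneg_left h1 (norm_nonneg _))))
      rw [e, mul_assoc]
      refine (norm_toLp_mulVec_le _ _).trans (mul_le_mul_of_nonneg_left ?_ (norm_nonneg _))
      refine (norm_toLp_mulVec_le _ _).trans ((mul_le_mul h2 h3 (norm_nonneg _)
        (by positivity)).trans_eq (by ring))
    have h0 := hΘlim.mul_const (c * (Z + ‖H‖ * D))
    rw [zero_mul] at h0
    have h4 := (squeeze_zero' (Eventually.of_forall fun k => norm_nonneg _) hmain h0).comp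
      (tendsto_add_atTop_nat 1)
    refine h4.congr fun N => ?_
    rw [gain_mulVec_smoothedState_sub Φ H hΓ χ₀ z N 0, Function.comp_apply, zero_add]

end Smoother
-- Kalman rank conditions and the augmented system.
theorem mulVec_injective_of_rank_eq {a b : Type*} [Fintype a] [Fintype b]
    {M : Matrix a b ℝ} (h : M.rank = Fintype.card b) : Function.Injective M.mulVec := by
  have h1 := M.mulVecLin.finrank_range_add_finrank_ker
  rw [← Matrix.rank, h, Module.finrank_fintype_fun_eq_card] at h1
  have h2 : LinearMap.ker M.mulVecLin = ⊥ := Submodule.finrank_eq_zero.1 (by omega)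
  exact LinearMap.ker_eq_bot.1 h2

variable {n m p : ℕ}

theorem Controllable.eq_zero {A : Matrix (Fin n) (Fin n) ℝ} {B : Matrix (Fin n) (Fin m) ℝ}
    (h : Controllable A B) {a : Fin n → ℝ} (ha : ∀ i < n, Bᵀ *ᵥ (Aᵀ ^ i *ᵥ a) = 0) : a = 0 := by
  have hinj := mulVec_injective_of_rank_eq (M := (controllabilityMatrix A B)ᵀ)
    (by rw [Matrix.rank_transpose, Fintype.card_fin]; exact h)
  refine hinj ?_
  rw [Matrix.mulVec_zero]
  ext ⟨i, j⟩
  have := congrFun (ha i i.2) j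
  rw [Matrix.mulVec_mulVec, ← Matrix.transpose_pow, ← Matrix.transpose_mul] at this
  exact this

theorem Observable.eq_zero {A : Matrix (Fin n) (Fin n) ℝ} {C : Matrix (Fin p) (Fin n) ℝ}
    (h : Observable A C) {x : Fin n → ℝ} (hx : ∀ i < n, C *ᵥ (A ^ i *ᵥ x) = 0) : x = 0 := by
  have hinj := mulVec_injective_of_rank_eq (M := observabilityMatrix A C)
    (by rw [Fintype.card_fin]; exact h)
  refine hinj ?_
  rw [Matrix.mulVec_zero]
  ext ⟨i, j⟩
  have := congrFun (hx i i.2) j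
  rw [Matrix.mulVec_mulVec] at this
  exact this

/-- `augQ` sees only the control block, which must therefore vanish at every step. The transposed
dynamics put `Bᵀ (Aᵀ)^i a` there at step `i + 1`, so one power beyond those for `(A, B)` is needed.
-/
theorem augmented_controllable {A : Matrix (Fin n) (Fin n) ℝ} {B : Matrix (Fin n) (Fin m) ℝ}
    (hAB : Controllable A B) {Rt : Matrix (Fin m) (Fin m) ℝ} (hRt : Rt.PosDef)
    (v : Fin n ⊕ Fin m → ℝ) (hv : ∀ i ≤ n, augQ Rt *ᵥ ((augPhi A B)ᵀ ^ i *ᵥ v) = 0) : v = 0 := by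
  have hinj : Function.Injective (Rt⁻¹).mulVec :=
    Matrix.mulVec_injective_iff_isUnit.2 hRt.inv.isUnit
  have hker : ∀ a b, augQ Rt *ᵥ (Sum.elim a b : Fin n ⊕ Fin m → ℝ) = 0 → b = 0 := by
    intro a b h
    refine hinj (funext fun i => ?_)
    have := congrFun h (Sum.inr i)
    rw [augQ, Matrix.fromBlocks_mulVec] at this
    simpa using this
  obtain ⟨a, b, rfl⟩ : ∃ a b, v = Sum.elim a b := ⟨_, _, (Sum.elim_comp_inl_inr v).symm⟩
  obtain rfl : b = 0 := hker a b (by simpa using hv 0 (Nat.zero_le _))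
  have hstep : ∀ c : Fin n → ℝ, (augPhi A B)ᵀ *ᵥ (Sum.elim c 0) =
      Sum.elim (Aᵀ *ᵥ c) (Bᵀ *ᵥ c) := by
    intro c
    rw [augPhi, Matrix.fromBlocks_transpose, Matrix.fromBlocks_mulVec]
    simp
  have hpow : ∀ i ≤ n, (augPhi A B)ᵀ ^ i *ᵥ (Sum.elim a 0) = Sum.elim (Aᵀ ^ i *ᵥ a) 0 ∧
      (i < n → Bᵀ *ᵥ (Aᵀ ^ i *ᵥ a) = 0) := by
    intro i
    induction i with
    | zero =>
      intro _
      refine ⟨by simp, fun h => ?_⟩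
      have h1 := hv 1 h
      rw [pow_one, hstep] at h1
      simpa using hker _ _ h1
    | succ i ih =>
      intro hi
      obtain ⟨h1, h2⟩ := ih (by omega)
      have h3 : (augPhi A B)ᵀ ^ (i + 1) *ᵥ (Sum.elim a 0) = Sum.elim (Aᵀ ^ (i + 1) *ᵥ a) 0 := by
        rw [pow_succ', ← Matrix.mulVec_mulVec, h1, hstep, h2 (by omega), Matrix.mulVec_mulVec,
          ← pow_succ']
      refine ⟨h3, fun h => ?_⟩
      have h4 := hv (i + 1 + 1) h
      rw [pow_succ', ← Matrix.mulVec_mulVec, h3, hstep] at h4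
      exact hker _ _ h4
  rw [hAB.eq_zero fun i hi => (hpow i hi.le).2 hi]
  simp

/-- The identity block of `augH` reveals the control, which must vanish; the state then evolves
under `A` alone. Power `n` is not needed here, but the range matches the controllability condition.
-/
theorem augmented_observable {A : Matrix (Fin n) (Fin n) ℝ} {C : Matrix (Fin p) (Fin n) ℝ}
    (hAC : Observable A C) (B : Matrix (Fin n) (Fin m) ℝ) (D : Matrix (Fin p) (Fin m) ℝ)
    (v : Fin n ⊕ Fin m → ℝ) (hv : ∀ i ≤ n, augH C D *ᵥ (augPhi A B ^ i *ᵥ v) = 0) : v = 0 := by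
  have hH : ∀ (x : Fin n → ℝ) (u : Fin m → ℝ),
      augH C D *ᵥ (Sum.elim x u) = Sum.elim (C *ᵥ x + D *ᵥ u) u := by
    intro x u
    rw [augH, Matrix.fromBlocks_mulVec]
    simp
  obtain ⟨x, u, rfl⟩ : ∃ x u, v = Sum.elim x u := ⟨_, _, (Sum.elim_comp_inl_inr v).symm⟩
  obtain rfl : u = 0 := by
    have h0 := hv 0 (Nat.zero_le _)
    rw [pow_zero, Matrix.one_mulVec, hH] at h0
    exact funext fun i => congrFun h0 (Sum.inr i)
  have hpow : ∀ i, augPhi A B ^ i *ᵥ (Sum.elim x 0) = Sum.elim (A ^ i *ᵥ x) 0 := by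
    intro i
    induction i with
    | zero => simp
    | succ i ih =>
      rw [pow_succ', ← Matrix.mulVec_mulVec, ih, augPhi, Matrix.fromBlocks_mulVec, pow_succ' A]
      simp
  have hx : x = 0 := hAC.eq_zero fun i hi => by
    have h1 := hv i hi.le
    rw [hpow, hH, Matrix.mulVec_zero, add_zero] at h1
    exact funext fun j => congrFun h1 (Sum.inl j)
  rw [hx]
  simp

theorem augQ_posSemidef {Rt : Matrix (Fin m) (Fin m) ℝ} (hRt : Rt.PosDef) :
    (augQ Rt : Matrix (Fin n ⊕ Fin m) (Fin n ⊕ Fin m) ℝ).PosSemidef := by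
  have h := hRt.inv
  refine .of_dotProduct_mulVec_nonneg ?_ fun x => ?_
  · rw [Matrix.IsHermitian, augQ, Matrix.fromBlocks_conjTranspose, h.isHermitian.eq]
    simp
  · have h1 := h.posSemidef.dotProduct_mulVec_nonneg (x ∘ Sum.inr)
    rw [augQ, Matrix.fromBlocks_mulVec]
    simpa [dotProduct] using h1

end ObservedControl

theorem corollary1 {n m p : ℕ}
    (A : Matrix (Fin n) (Fin n) ℝ) (B : Matrix (Fin n) (Fin m) ℝ)
    (C : Matrix (Fin p) (Fin n) ℝ) (D : Matrix (Fin p) (Fin m) ℝ)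
    (hAB : ObservedControl.Controllable A B) (hAC : ObservedControl.Observable A C)
    (W : Matrix (Fin p) (Fin p) ℝ) (M : Matrix (Fin p) (Fin m) ℝ)
    (R Rt : Matrix (Fin m) (Fin m) ℝ)
    (hW : (ObservedControl.costWeight W M R).PosDef) (hRt : Rt.PosDef)
    (x₀ : Fin n → ℝ) (uLast : Fin m → ℝ)
    (z : ℕ → Fin p ⊕ Fin m → ℝ) (ℓ : ℝ)
    (hz : ∀ k, ‖WithLp.toLp 2 (z (k + 1) - z k)‖ ≤ ℓ) :
    Tendsto (ObservedControl.gainAccumulator A B C D W M R Rt) atTop (𝓝 0) ∧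
    ∀ δ₁ : ℝ, 0 < δ₁ → ∃ N₀ : ℕ, 1 ≤ N₀ ∧ ∀ N : ℕ, N₀ ≤ N →
      ‖ObservedControl.control A B C D W M R Rt x₀ uLast z N -
        ObservedControl.control A B C D W M R Rt x₀ uLast z (N - 1)‖ ≤ δ₁ := by
  obtain ⟨h1, h2⟩ := ObservedControl.tendsto_smoother (ObservedControl.augPhi A B)
    (ObservedControl.augH C D) (ObservedControl.augQ_posSemidef hRt) hW.inv
    (ObservedControl.augmented_observable hAC B D) (ObservedControl.augmented_controllable hAB hRt)
    (Γ := ObservedControl.gainAccumulator A B C D W M R Rt) (fun _ => rfl)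
    (Sum.elim x₀ uLast) hz
  refine ⟨h1, fun δ₁ hδ => ?_⟩
  obtain ⟨N₁, hN₁⟩ := eventually_atTop.1 (h2.eventually_lt_const hδ)
  refine ⟨N₁ + 1, by omega, fun N hN => ?_⟩
  obtain ⟨N, rfl⟩ : ∃ N', N = N' + 1 := ⟨N - 1, by omega⟩
  -- The initial accumulator `[0 I]` extracts the control block, so the smoother difference is
  -- exactly the difference of controls.
  refine le_of_eq_of_le (congrArg norm ?_) (hN₁ N (by omega)).le
  rw [Nat.add_sub_cancel, ObservedControl.control, ObservedControl.control, ← WithLp.toLp_sub,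
    ObservedControl.gainAccumulator, Matrix.fromCols_mulVec]
  congr 1
  ext i
  simp
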